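/- **Theorem 3.3.** All spaces are real. For a Banach lattice $E$ and a real number $\varepsilon$, a linear map $T:E\to E$ (not assumed continuous) is called *$\varepsilon$-band preserving* ($\varepsilon$-BP) if for every $x\in E$ $$\sup\{\||Tx|\wedge y\| : y\in E,\ y\ge 0,\ y\perp x\}\le \varepsilon\|x\|,$$ where $y\perp x$ means $|y|\wedge|x|=0$. The Banach lattice $E$ has the *Fatou property* if there is a constant $\mathfrak f$ such that $\|x\|\le \mathfrak f\,\sup_i\|x_i\|$ whenever $(x_i)$ is an increasing net of non-negative elements of $E$ with $\sup_i\|x_i\|<\infty$ that has a supremum $x=\bigvee_i x_i$ in $E$. A *Köthe function space* on a $\sigma$-finite measure space $(\Omega,\Sigma,\mu)$ is a Banach space $X$ consisting of classes, modulo equality $\mu$-a.e., of measurable real functions on $\Omega$ that are integrable on every set of finite measure, such that (1) if $f$ is measurable, $g\in X$ and $|f|\le|g|$ a.e., then $f\in X$ and $\|f\|\le\|g\|$; and (2) $\chi_S\in X$ for every $S\in\Sigma$ with $0<\mu(S)<\infty$; it is ordered by the a.e. order. For a locally compact Hausdorff space $K$ and a Banach lattice $X$, $C_0(K,X)$ is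 the Banach lattice of continuous functions $f:K\to X$ vanishing at infinity, with the norm $\|f\|=\sup_{t\in K}\|f(t)\|_X$ and the pointwise order. Let $X$ be a Köthe function space with the Fatou property on a $\sigma$-finite measure space, and let $K$ be a locally compact Hausdorff space. Then, for every $\varepsilon$, every $\varepsilon$-BP linear map $T:C_0(K,X)\to C_0(K,X)$ is continuous. In particular, for every locally compact Hausdorff space $K$ and every $\varepsilon$, every $\varepsilon$-BP linear map on $C_0(K)=C_0(K,\mathbb R)$ is continuous. -/

import Mathlib

open MeasureTheory
open scoped ZeroAtInfty

/-! ### Banach lattice notions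

A real Banach lattice is encoded with Mathlib's classes `NormedAddCommGroup`, `NormedSpace ℝ`,
`Lattice`, `IsOrderedAddMonoid`, `HasSolidNorm`, `CompleteSpace`. -/

/-- `T` is `ε`-band preserving: for every `x`,
`sup {‖|T x| ⊓ y‖ : 0 ≤ y, y ⊥ x} ≤ ε ‖x‖`, where `y ⊥ x` means `|y| ⊓ |x| = 0`. -/
def IsEpsBandPreserving {E : Type*} [NormedAddCommGroup E] [NormedSpace ℝ E] [Lattice E]
    (ε : ℝ) (T : E →ₗ[ℝ] E) : Prop :=
  ∀ x y : E, 0 ≤ y → |y| ⊓ |x| = 0 → ‖|T x| ⊓ y‖ ≤ ε * ‖x‖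

/-- `E` has Fatou norm with constant `c`: every norm-bounded increasing net of non-negative
elements with a supremum `x` in `E` satisfies `‖x‖ ≤ c * sup ‖xᵢ‖`. Increasing nets are given by
their ranges, the nonempty upward directed sets. -/
def HasFatouNormWith (E : Type*) [NormedAddCommGroup E] [Lattice E] (c : ℝ) : Prop :=
  ∀ S : Set E, S.Nonempty → DirectedOn (· ≤ ·) S → (∀ s ∈ S, 0 ≤ s) →
    BddAbove ((fun s : E => ‖s‖) '' S) →
    ∀ x : E, IsLUB S x → ‖x‖ ≤ c * sSup ((fun s : E => ‖s‖) '' S)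

/-- The Fatou property: the norm is Fatou with some constant. -/
def HasFatouProperty (E : Type*) [NormedAddCommGroup E] [Lattice E] : Prop :=
  ∃ c : ℝ, HasFatouNormWith E c

/-! ### Köthe function spaces -/

/-- A Köthe function space on `(Ω, μ)`: a linear space of a.e.-classes of real functions,
integrable on all measurable sets of finite measure, with a complete norm, which is solid
and contains the indicators of all measurable sets of finite positive measure. -/
structure KotheFunctionSpace {Ω : Type*} [MeasurableSpace Ω] (μ : Measure Ω) where
  /-- the underlying linear space of a.e.-classes of functions -/
  toSubmodule : Submodule ℝ (Ω →ₘ[μ] ℝ)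
  /-- the norm function -/
  norm : Norm toSubmodule
  core : NormedSpace.Core ℝ toSubmodule
  complete : letI := NormedAddCommGroup.ofCore core; CompleteSpace toSubmodule
  integrableOn : ∀ f ∈ toSubmodule, ∀ s : Set Ω, MeasurableSet s → μ s < ⊤ → IntegrableOn f s μ
  solid_mem : ∀ (f : Ω →ₘ[μ] ℝ) (g : toSubmodule),
    (∀ᵐ ω ∂μ, |f ω| ≤ |(g : Ω →ₘ[μ] ℝ) ω|) → f ∈ toSubmodule
  solid_norm : ∀ f g : toSubmodule,
    (∀ᵐ ω ∂μ, |(f : Ω →ₘ[μ] ℝ) ω| ≤ |(g : Ω →ₘ[μ] ℝ) ω|) → ‖f‖ ≤ ‖g‖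
  indicator_mem : ∀ (s : Set Ω) (hs : MeasurableSet s), 0 < μ s → μ s < ⊤ →
    AEEqFun.mk (s.indicator fun _ => (1 : ℝ))
      (stronglyMeasurable_const.indicator hs).aestronglyMeasurable ∈ toSubmodule

namespace KotheFunctionSpace

variable {Ω : Type*} [MeasurableSpace Ω] {μ : Measure Ω}

instance : CoeSort (KotheFunctionSpace μ) (Type _) := ⟨fun X => X.toSubmodule⟩

noncomputable instance instNormedAddCommGroup (X : KotheFunctionSpace μ) :
    NormedAddCommGroup X :=
  letI := X.norm
  NormedAddCommGroup.ofCore X.core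

noncomputable instance instNormedSpace (X : KotheFunctionSpace μ) : NormedSpace ℝ X :=
  letI := X.norm
  NormedSpace.ofCore X.core

instance instCompleteSpace (X : KotheFunctionSpace μ) : CompleteSpace X := X.complete

theorem sup_mem (X : KotheFunctionSpace μ) {f g : Ω →ₘ[μ] ℝ} (hf : f ∈ X.toSubmodule)
    (hg : g ∈ X.toSubmodule) : f ⊔ g ∈ X.toSubmodule := by
  have habs : ∀ h ∈ X.toSubmodule, |h| ∈ X.toSubmodule := fun h hh => by
    refine X.solid_mem _ ⟨h, hh⟩ ?_
    filter_upwards [AEEqFun.coeFn_abs h] with ω h1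
    simp [h1]
  refine X.solid_mem _ ⟨|f| + |g|, X.toSubmodule.add_mem (habs f hf) (habs g hg)⟩ ?_
  filter_upwards [AEEqFun.coeFn_sup f g, AEEqFun.coeFn_add |f| |g|, AEEqFun.coeFn_abs f,
    AEEqFun.coeFn_abs g] with ω h1 h2 h3 h4
  simp only [h1, h2, Pi.add_apply, h3, h4]
  rw [abs_of_nonneg (add_nonneg (abs_nonneg (f ω)) (abs_nonneg (g ω)))]
  exact norm_sup_le_add (f ω) (g ω)

theorem inf_mem (X : KotheFunctionSpace μ) {f g : Ω →ₘ[μ] ℝ} (hf : f ∈ X.toSubmodule)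
    (hg : g ∈ X.toSubmodule) : f ⊓ g ∈ X.toSubmodule := by
  have h := X.toSubmodule.neg_mem
    (X.sup_mem (X.toSubmodule.neg_mem hf) (X.toSubmodule.neg_mem hg))
  have e : f ⊓ g = -(-f ⊔ -g) := by
    refine AEEqFun.ext ?_
    filter_upwards [AEEqFun.coeFn_inf f g, AEEqFun.coeFn_neg (-f ⊔ -g),
      AEEqFun.coeFn_sup (-f) (-g), AEEqFun.coeFn_neg f, AEEqFun.coeFn_neg g]
      with ω h1 h2 h3 h4 h5
    simp [h1, h2, h3, h4, h5, neg_sup]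
  rwa [e]

/-- The order of a Köthe function space is the a.e. order. -/
noncomputable instance instLattice (X : KotheFunctionSpace μ) : Lattice X :=
  Subtype.lattice (fun _ _ hf hg => X.sup_mem hf hg) (fun _ _ hf hg => X.inf_mem hf hg)

instance instIsOrderedAddMonoid (X : KotheFunctionSpace μ) : IsOrderedAddMonoid X where
  add_le_add_left f g hfg h := by
    change (f : Ω →ₘ[μ] ℝ) + h ≤ (g : Ω →ₘ[μ] ℝ) + h
    have hfg' : (f : Ω →ₘ[μ] ℝ) ≤ g := hfg
    rw [← AEEqFun.coeFn_le] at hfg' ⊢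
    filter_upwards [hfg', AEEqFun.coeFn_add (f : Ω →ₘ[μ] ℝ) h,
      AEEqFun.coeFn_add (g : Ω →ₘ[μ] ℝ) h] with ω h1 h2 h3
    rw [h2, h3]
    exact add_le_add_left h1 _

instance instHasSolidNorm (X : KotheFunctionSpace μ) : HasSolidNorm X where
  solid f g hfg := by
    refine X.solid_norm f g ?_
    have hfg' : |(f : Ω →ₘ[μ] ℝ)| ≤ |(g : Ω →ₘ[μ] ℝ)| := hfg
    rw [← AEEqFun.coeFn_le] at hfg'
    filter_upwards [hfg', AEEqFun.coeFn_abs (f : Ω →ₘ[μ] ℝ),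
      AEEqFun.coeFn_abs (g : Ω →ₘ[μ] ℝ)] with ω h1 h2 h3
    rwa [h2, h3] at h1

end KotheFunctionSpace

/-! ### The pointwise lattice structure of `C₀(K, E)`

The norm of `C₀(K, E)` is Mathlib's supremum norm. -/

namespace ZeroAtInftyContinuousMap

variable {K E : Type*} [TopologicalSpace K] [NormedAddCommGroup E] [Lattice E] [HasSolidNorm E]
  [IsOrderedAddMonoid E]

instance instPartialOrderPointwise : PartialOrder C₀(K, E) :=
  PartialOrder.lift (fun f : C₀(K, E) => (f : K → E)) DFunLike.coe_injective

instance instMaxPointwise : Max C₀(K, E) where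
  max f g :=
    { toFun := fun t => f t ⊔ g t
      continuous_toFun := (map_continuous f).sup (map_continuous g)
      zero_at_infty' := by
        have h := (zero_at_infty f).sup_nhds (zero_at_infty g)
        rwa [sup_idem] at h }

instance instMinPointwise : Min C₀(K, E) where
  min f g :=
    { toFun := fun t => f t ⊓ g t
      continuous_toFun := (map_continuous f).inf (map_continuous g)
      zero_at_infty' := by
        have h := (zero_at_infty f).inf_nhds (zero_at_infty g)
        rwa [inf_idem] at h }

instance instLatticePointwise : Lattice C₀(K, E) :=
  DFunLike.coe_injective.lattice (fun f : C₀(K, E) => (f : K → E))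
    Iff.rfl Iff.rfl (fun _ _ => rfl) (fun _ _ => rfl)

end ZeroAtInftyContinuousMap

/-! Testing band preservation with the absolute value of the part of `T f` over a region where `f`
vanishes shows that this part has norm at most `ε * ‖f‖`. So only the local action of `T` can be
unbounded.

If it is, disjoint pieces carry vectors `z n` with `T (z n)` huge over the `n`-th piece. Some `x = ∑
a m • z m` then has `T x` arbitrarily large over the pieces, since `x - a n • z n` vanishes over the
`n`-th one (`gliding_hump`).

The argument runs twice, with measurable pieces of `Ω` and with open pieces of `K`. The crux each
time is `exists_split_of_unbounded`: a bad piece contains a witness whose removal leaves a bad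
piece. In `K`, two nearby points suffice, unless the point is isolated, where continuity on `X` is
used. In `Ω`, failure of splitting makes all sets with bad complement uniformly good. A maximal such
set exists by exhaustion and the Fatou property, and what it leaves is an atom, where the space is
at most one-dimensional. -/

theorem gliding_hump {E F G : Type*} [NormedAddCommGroup E] [NormedSpace ℝ E] [CompleteSpace E]
    [SeminormedAddCommGroup F] [Module ℝ F] [SeminormedAddCommGroup G] [NormedSpace ℝ G]
    (T : E →ₗ[ℝ] F) (L : ℕ → F →ₗ[ℝ] G) (hL : ∀ n v, ‖L n v‖ ≤ ‖v‖) (z : ℕ → E) {ε : ℝ}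
    (hε : 0 ≤ ε)
    (hz : ∀ (a : ℕ → ℝ) (x : E), HasSum (fun m => a m • z m) x →
      ∀ n, ‖L n (T (x - a n • z n))‖ ≤ ε * ‖x - a n • z n‖)
    (hbig : ∀ n : ℕ, 2 ^ n * n * ‖z n‖ < ‖L n (T (z n))‖) : False := by
  have hz0 : ∀ n, 0 < ‖z n‖ := fun n => by
    rw [norm_pos_iff]
    intro h0
    have := hbig n
    simp [h0] at this
  -- Scaling to norm `2⁻ⁿ` makes the series converge absolutely, while the factor `2 ^ n * n` in
  -- `hbig` still leaves an image of size at least `n`.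
  set a : ℕ → ℝ := fun n => (1 / 2) ^ n * ‖z n‖⁻¹ with ha
  have ha0 : ∀ n, 0 < a n := fun n => by have := hz0 n; positivity
  have hnorm : ∀ n, ‖a n • z n‖ = (1 / 2) ^ n := fun n => by
    rw [norm_smul, Real.norm_of_nonneg (ha0 n).le, ha, mul_assoc, inv_mul_cancel₀ (hz0 n).ne',
      mul_one]
  have hs : Summable fun n => a n • z n :=
    Summable.of_norm (by simpa only [hnorm] using summable_geometric_two)
  obtain ⟨x, hx⟩ := hs
  obtain ⟨n, hn⟩ := exists_nat_gt (‖T x‖ + ε * (‖x‖ + 1))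
  have h1 : (n : ℝ) ≤ ‖L n (T (a n • z n))‖ := by
    rw [map_smul, map_smul, norm_smul, Real.norm_of_nonneg (ha0 n).le]
    calc (n : ℝ) = a n * (2 ^ n * n * ‖z n‖) := by
          have := (hz0 n).ne'
          simp only [ha, one_div, inv_pow]
          field_simp
      _ ≤ _ := mul_le_mul_of_nonneg_left (hbig n).le (ha0 n).le
  have h2 : L n (T (a n • z n)) = L n (T x) - L n (T (x - a n • z n)) := by
    simp only [map_sub, sub_sub_cancel]
  have h3 : ‖x - a n • z n‖ ≤ ‖x‖ + 1 :=
    (norm_sub_le _ _).trans (by rw [hnorm]; gcongr; exact pow_le_one₀ (by norm_num) (by norm_num))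
  have h4 := norm_sub_le (L n (T x)) (L n (T (x - a n • z n)))
  have h5 := mul_le_mul_of_nonneg_left h3 hε
  rw [h2] at h1
  linarith [hz a x hx n, hL n (T x)]

/-- Iterated splitting of the remainder: each `V n` misses the next remainder, which contains all
later pieces. -/
theorem exists_pairwise_disjoint_seq {α : Type*} {P : Set α → Prop} {Q : ℕ → Set α → Prop}
    (h : ∀ n U, P U → ∃ V W, V ⊆ U ∧ W ⊆ U ∧ Disjoint V W ∧ Q n V ∧ P W) {U₀ : Set α}
    (hU₀ : P U₀) :
    ∃ V : ℕ → Set α, (∀ m n, m ≠ n → Disjoint (V m) (V n)) ∧ ∀ n, Q n (V n) := by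
  choose! V W hVU hWU hd hQ hW using h
  let U : ℕ → Set α := fun n => Nat.rec U₀ (fun k A => W k A) n
  have hU : ∀ n, P (U n) := fun n => by
    induction n with
    | zero => exact hU₀
    | succ k ih => exact hW k _ ih
  have hanti : Antitone U := antitone_nat_of_succ_le fun n => hWU n _ (hU n)
  have hlt : ∀ m n, m < n → Disjoint (V m (U m)) (V n (U n)) := fun m n hmn =>
    (hd m _ (hU m)).mono_right ((hVU n _ (hU n)).trans (hanti hmn))
  refine ⟨fun n => V n (U n), fun m n hmn => ?_, fun n => hQ n _ (hU n)⟩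
  rcases lt_or_gt_of_ne hmn with h | h
  exacts [hlt m n h, (hlt n m h).symm]

theorem IsEpsBandPreserving.mono {E : Type*} [NormedAddCommGroup E] [NormedSpace ℝ E] [Lattice E]
    {ε δ : ℝ} {T : E →ₗ[ℝ] E} (hT : IsEpsBandPreserving ε T) (h : ε ≤ δ) :
    IsEpsBandPreserving δ T := fun x y hy hd =>
  (hT x y hy hd).trans (mul_le_mul_of_nonneg_right h (norm_nonneg x))

/-! ### Band projections on a Köthe function space -/

namespace KotheFunctionSpace

variable {Ω : Type*} [MeasurableSpace Ω] {μ : Measure Ω} (X : KotheFunctionSpace μ)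

/-- The band projection onto the functions supported in the measurable set `A`. -/
noncomputable def proj {A : Set Ω} (hA : MeasurableSet A) : X →ₗ[ℝ] X where
  toFun f := ⟨AEEqFun.mk (A.indicator (f : Ω →ₘ[μ] ℝ))
      ((AEEqFun.aestronglyMeasurable _).indicator hA), by
    refine X.solid_mem _ f ?_
    filter_upwards [AEEqFun.coeFn_mk (A.indicator (f : Ω →ₘ[μ] ℝ))
      ((AEEqFun.aestronglyMeasurable _).indicator hA)] with ω h
    rw [h]
    by_cases hω : ω ∈ A <;> simp [hω]⟩
  map_add' f g := by
    refine Subtype.ext (AEEqFun.ext ?_)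
    change (AEEqFun.mk _ _ : Ω →ₘ[μ] ℝ) =ᵐ[μ] ((AEEqFun.mk _ _ : Ω →ₘ[μ] ℝ) + AEEqFun.mk _ _ :)
    refine (AEEqFun.coeFn_mk _ _).trans ((?_ : _ =ᵐ[μ] _).trans (AEEqFun.coeFn_add _ _).symm)
    filter_upwards [AEEqFun.coeFn_add (f : Ω →ₘ[μ] ℝ) g,
      AEEqFun.coeFn_mk (A.indicator (f : Ω →ₘ[μ] ℝ))
        ((AEEqFun.aestronglyMeasurable _).indicator hA),
      AEEqFun.coeFn_mk (A.indicator (g : Ω →ₘ[μ] ℝ))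
        ((AEEqFun.aestronglyMeasurable _).indicator hA)] with ω h1 h2 h3
    by_cases hω : ω ∈ A <;> simp [hω, h2, h3, h1]
  map_smul' c f := by
    refine Subtype.ext (AEEqFun.ext ?_)
    change (AEEqFun.mk _ _ : Ω →ₘ[μ] ℝ) =ᵐ[μ] (c • (AEEqFun.mk _ _ : Ω →ₘ[μ] ℝ) :)
    refine (AEEqFun.coeFn_mk _ _).trans ((?_ : _ =ᵐ[μ] _).trans (AEEqFun.coeFn_smul _ _).symm)
    filter_upwards [AEEqFun.coeFn_smul c (f : Ω →ₘ[μ] ℝ),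
      AEEqFun.coeFn_mk (A.indicator (f : Ω →ₘ[μ] ℝ))
        ((AEEqFun.aestronglyMeasurable _).indicator hA)] with ω h1 h2
    by_cases hω : ω ∈ A <;> simp [hω, h2, h1]

variable {A B C : Set Ω}

theorem coeFn_proj (hA : MeasurableSet A) (f : X) :
    (X.proj hA f : Ω →ₘ[μ] ℝ) =ᵐ[μ] A.indicator (f : Ω →ₘ[μ] ℝ) :=
  AEEqFun.coeFn_mk _ _

theorem norm_proj_le (hA : MeasurableSet A) (f : X) : ‖X.proj hA f‖ ≤ ‖f‖ := by
  refine X.solid_norm _ _ ?_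
  filter_upwards [X.coeFn_proj hA f] with ω h
  rw [h]
  by_cases hω : ω ∈ A <;> simp [hω]

theorem ext_ae {f g : X} (h : (f : Ω →ₘ[μ] ℝ) =ᵐ[μ] (g : Ω →ₘ[μ] ℝ)) : f = g :=
  Subtype.ext (AEEqFun.ext h)

theorem proj_proj (hA : MeasurableSet A) (hB : MeasurableSet B) (f : X) :
    X.proj hA (X.proj hB f) = X.proj (hA.inter hB) f := by
  refine X.ext_ae ?_
  filter_upwards [X.coeFn_proj hA (X.proj hB f), X.coeFn_proj hB f,
    X.coeFn_proj (hA.inter hB) f] with ω h1 h2 h3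
  rw [h1, h3]
  by_cases hω : ω ∈ A <;> by_cases hω' : ω ∈ B <;> simp [hω, hω', h2]

theorem proj_add_proj_of_disjoint (hA : MeasurableSet A) (hB : MeasurableSet B)
    (h : Disjoint A B) (f : X) :
    X.proj hA f + X.proj hB f = X.proj (hA.union hB) f := by
  refine X.ext_ae ((AEEqFun.coeFn_add _ _).trans ?_)
  filter_upwards [X.coeFn_proj hA f, X.coeFn_proj hB f,
    X.coeFn_proj (hA.union hB) f] with ω h1 h2 h3
  rw [Pi.add_apply, h1, h2, h3, Set.indicator_union_of_disjoint h]

theorem proj_eq_zero_of_null (hA : MeasurableSet A) (h : μ A = 0) (f : X) :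
    X.proj hA f = 0 := by
  refine X.ext_ae (Filter.EventuallyEq.trans ?_ AEEqFun.coeFn_zero.symm)
  filter_upwards [X.coeFn_proj hA f, measure_eq_zero_iff_ae_notMem.1 h] with ω h1 h2
  simp [h1, h2]

theorem norm_proj_mono (hA : MeasurableSet A) (hB : MeasurableSet B) (h : A ⊆ B) (f : X) :
    ‖X.proj hA f‖ ≤ ‖X.proj hB f‖ := by
  have := X.norm_proj_le hA (X.proj hB f)
  rw [proj_proj] at this
  simpa only [Set.inter_eq_left.2 h] using this

theorem coeFn_abs (f : X) : ((|f| : X) : Ω →ₘ[μ] ℝ) =ᵐ[μ] fun ω => |(f : Ω →ₘ[μ] ℝ) ω| :=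
  AEEqFun.coeFn_abs (f : Ω →ₘ[μ] ℝ)

theorem le_iff_ae {f g : X} :
    f ≤ g ↔ ∀ᵐ ω ∂μ, (f : Ω →ₘ[μ] ℝ) ω ≤ (g : Ω →ₘ[μ] ℝ) ω :=
  (AEEqFun.coeFn_le (f := (f : Ω →ₘ[μ] ℝ)) (g := (g : Ω →ₘ[μ] ℝ))).symm

/-- Vectors vanishing on `A` have images almost vanishing on `A`. -/
theorem norm_proj_apply_le {ε : ℝ} {S : X →ₗ[ℝ] X} (hS : IsEpsBandPreserving ε S)
    (hA : MeasurableSet A) {f : X} (hf : X.proj hA f = 0) :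
    ‖X.proj hA (S f)‖ ≤ ε * ‖f‖ := by
  -- The test vector is `y = |X.proj hA (S f)|`, which is disjoint from `f` and dominated by `|S
  -- f|`.
  have hd : |(|X.proj hA (S f)| : X)| ⊓ |f| = 0 := by
    rw [abs_abs]
    refine X.ext_ae ((AEEqFun.coeFn_inf _ _).trans
      ((?_ : _ =ᵐ[μ] _).trans AEEqFun.coeFn_zero.symm))
    have h0 : ((X.proj hA f : X) : Ω →ₘ[μ] ℝ) =ᵐ[μ] 0 := by
      rw [hf]; exact AEEqFun.coeFn_zero
    filter_upwards [X.coeFn_abs (X.proj hA (S f)), X.coeFn_proj hA (S f), X.coeFn_abs f,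
      X.coeFn_proj hA f, h0] with ω h1 h2 h3 h4 h5
    rw [h1, h2, h3]
    rw [h5] at h4
    by_cases hω : ω ∈ A
    · simp only [hω, Set.indicator_of_mem, Pi.zero_apply] at h4
      simp [← h4]
    · simp [hω]
  have hle : |S f| ⊓ |X.proj hA (S f)| = |X.proj hA (S f)| := by
    rw [inf_eq_right, X.le_iff_ae]
    filter_upwards [X.coeFn_abs (X.proj hA (S f)), X.coeFn_proj hA (S f), X.coeFn_abs (S f)]
      with ω h1 h2 h3
    rw [h1, h2, h3]
    by_cases hω : ω ∈ A <;> simp [hω]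
  have := hS f (|X.proj hA (S f)|) (abs_nonneg _) hd
  rwa [hle, norm_abs_eq_norm] at this

/-- The Fatou property for increasing sequences of band projections. -/
theorem norm_proj_iUnion_le {c : ℝ} (hc : HasFatouNormWith X c) {D : ℕ → Set Ω}
    (hD : ∀ n, MeasurableSet (D n)) (hmono : Monotone D) (f : X) {M : ℝ}
    (hM : ∀ n, ‖X.proj (hD n) f‖ ≤ M) :
    ‖X.proj (MeasurableSet.iUnion hD) f‖ ≤ |c| * M := by
  have habs : ∀ n, ‖(|X.proj (hD n) f| : X)‖ ≤ M := fun n => by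
    rw [norm_abs_eq_norm]; exact hM n
  have key := hc (Set.range fun n => (|X.proj (hD n) f| : X)) (Set.range_nonempty _)
    (directedOn_range.2 (Monotone.directed_le fun m n hmn => by
      rw [X.le_iff_ae]
      filter_upwards [X.coeFn_abs (X.proj (hD m) f), X.coeFn_abs (X.proj (hD n) f),
        X.coeFn_proj (hD m) f, X.coeFn_proj (hD n) f] with ω h1 h2 h3 h4
      rw [h1, h2, h3, h4]
      by_cases hω : ω ∈ D m
      · simp [hω, hmono hmn hω]
      · simp [hω]))
    (by rintro _ ⟨n, rfl⟩; exact abs_nonneg _)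
    ⟨M, by rintro _ ⟨_, ⟨n, rfl⟩, rfl⟩; exact habs n⟩
    (|X.proj (MeasurableSet.iUnion hD) f|) ?_
  · rw [norm_abs_eq_norm] at key
    refine key.trans ?_
    have h0 : 0 ≤ sSup ((fun s : X => ‖s‖) '' Set.range fun n => (|X.proj (hD n) f| : X)) :=
      Real.sSup_nonneg (by rintro _ ⟨_, _, rfl⟩; exact norm_nonneg _)
    have h1 : sSup ((fun s : X => ‖s‖) '' Set.range fun n => (|X.proj (hD n) f| : X)) ≤ M :=
      csSup_le ((Set.range_nonempty _).image _)
        (by rintro _ ⟨_, ⟨n, rfl⟩, rfl⟩; exact habs n)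
    exact (mul_le_mul_of_nonneg_right (le_abs_self c) h0).trans
      (mul_le_mul_of_nonneg_left h1 (abs_nonneg c))
  · constructor
    · rintro _ ⟨n, rfl⟩
      rw [X.le_iff_ae]
      filter_upwards [X.coeFn_abs (X.proj (hD n) f),
        X.coeFn_abs (X.proj (MeasurableSet.iUnion hD) f),
        X.coeFn_proj (hD n) f, X.coeFn_proj (MeasurableSet.iUnion hD) f] with ω h1 h2 h3 h4
      rw [h1, h2, h3, h4]
      by_cases hω : ω ∈ D n
      · have : ω ∈ ⋃ i, D i := Set.mem_iUnion_of_mem n hω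
        rw [Set.indicator_of_mem hω, Set.indicator_of_mem this]
      · rw [Set.indicator_of_notMem hω, abs_zero]; exact abs_nonneg _
    · intro w hw
      have hw' : ∀ n, ∀ᵐ ω ∂μ,
          ((|X.proj (hD n) f| : X) : Ω →ₘ[μ] ℝ) ω ≤ (w : Ω →ₘ[μ] ℝ) ω := fun n =>
        X.le_iff_ae.1 (hw ⟨n, rfl⟩)
      rw [X.le_iff_ae]
      filter_upwards [ae_all_iff.2 hw',
        ae_all_iff.2 fun n => X.coeFn_abs (X.proj (hD n) f),
        X.coeFn_abs (X.proj (MeasurableSet.iUnion hD) f),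
        ae_all_iff.2 fun n => X.coeFn_proj (hD n) f,
        X.coeFn_proj (MeasurableSet.iUnion hD) f] with ω h0 h1 h2 h3 h4
      rw [h2, h4]
      by_cases hω : ω ∈ ⋃ i, D i
      · obtain ⟨n, hn⟩ := Set.mem_iUnion.1 hω
        have := h0 n
        rwa [h1, h3, Set.indicator_of_mem hn, ← Set.indicator_of_mem hω (f : Ω →ₘ[μ] ℝ)] at this
      · have := h0 0
        rw [h1] at this
        rw [Set.indicator_of_notMem hω, abs_zero]
        exact (abs_nonneg _).trans this

end KotheFunctionSpace

/-! ### Almost band preserving maps on a Köthe function space -/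

namespace KotheFunctionSpace

variable {Ω : Type*} [MeasurableSpace Ω] {μ : Measure Ω} (X : KotheFunctionSpace μ)

/-- The compression of `S` to the band of functions supported in `A` is bounded by `C`. -/
def CompressionBound (S : X →ₗ[ℝ] X) (C : ℝ) (A : Set Ω) : Prop :=
  ∀ (hA : MeasurableSet A) (f : X), ‖X.proj hA (S (X.proj hA f))‖ ≤ C * ‖f‖

variable {X} {S : X →ₗ[ℝ] X} {A B : Set Ω} {ε : ℝ}

theorem CompressionBound.subset {C : ℝ} (h : X.CompressionBound S C B) (hB : MeasurableSet B)
    (hC : 0 ≤ C) (hAB : A ⊆ B) : X.CompressionBound S C A := fun hA f => by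
  have h1 := h hB (X.proj hA f)
  simp only [proj_proj, Set.inter_eq_right.2 hAB] at h1
  exact (X.norm_proj_mono hA hB hAB _).trans
    (h1.trans (mul_le_mul_of_nonneg_left (X.norm_proj_le hA f) hC))

theorem CompressionBound.mono {C C' : ℝ} (h : X.CompressionBound S C A) (hC : C ≤ C') :
    X.CompressionBound S C' A := fun hA f =>
  (h hA f).trans (mul_le_mul_of_nonneg_right hC (norm_nonneg f))

theorem norm_proj_apply_proj_le (hS : IsEpsBandPreserving ε S) (hε : 0 ≤ ε)
    (hA : MeasurableSet A) (hB : MeasurableSet B) (hAB : Disjoint A B) (f : X) :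
    ‖X.proj hA (S (X.proj hB f))‖ ≤ ε * ‖f‖ := by
  refine (X.norm_proj_apply_le hS hA ?_).trans
    (mul_le_mul_of_nonneg_left (X.norm_proj_le hB f) hε)
  rw [proj_proj]
  exact X.proj_eq_zero_of_null _ (by rw [hAB.inter_eq, measure_empty]) f

/-- In the two-by-two block decomposition over `A` and `B`, the off-diagonal blocks cost only `ε`
each. -/
theorem CompressionBound.union_of_disjoint (hS : IsEpsBandPreserving ε S) (hε : 0 ≤ ε)
    {C C' : ℝ} (h : X.CompressionBound S C A) (h' : X.CompressionBound S C' B)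
    (hA : MeasurableSet A) (hB : MeasurableSet B) (hAB : Disjoint A B) :
    X.CompressionBound S (C + ε + (C' + ε)) (A ∪ B) := fun hU f => by
  have e : ∀ g, X.proj hU g = X.proj hA g + X.proj hB g := fun g =>
    (X.proj_add_proj_of_disjoint hA hB hAB g).symm
  have h1 := X.norm_proj_apply_proj_le hS hε hA hB hAB f
  have h2 := X.norm_proj_apply_proj_le hS hε hB hA hAB.symm f
  rw [e (S _), e f, map_add, map_add, map_add]
  refine (norm_add_le _ _).trans ?_
  have h3 := norm_add_le (X.proj hA (S (X.proj hA f))) (X.proj hA (S (X.proj hB f)))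
  have h4 := norm_add_le (X.proj hB (S (X.proj hA f))) (X.proj hB (S (X.proj hB f)))
  linarith [h hA f, h' hB f]

theorem exists_compressionBound_union (hS : IsEpsBandPreserving ε S) (hε : 0 ≤ ε)
    (h : ∃ C, X.CompressionBound S C A) (h' : ∃ C, X.CompressionBound S C B)
    (hA : MeasurableSet A) (hB : MeasurableSet B) :
    ∃ C, X.CompressionBound S C (A ∪ B) := by
  obtain ⟨C, hC⟩ := h
  obtain ⟨C', hC'⟩ := h'
  have := CompressionBound.union_of_disjoint hS hε hC
    ((hC'.mono (le_abs_self C')).subset hB (abs_nonneg _) (Set.sdiff_subset (t := A)))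
    hA (hB.diff hA) Set.disjoint_sdiff_right
  rw [Set.union_sdiff_self] at this
  exact ⟨_, this⟩

/-- On an atom the space is one-dimensional, so every linear map is bounded there. -/
theorem exists_compressionBound_of_atom (S : X →ₗ[ℝ] X) (hA : MeasurableSet A)
    (h : ∀ E ⊆ A, MeasurableSet E → μ E = 0 ∨ μ (A \ E) = 0) :
    ∃ C, X.CompressionBound S C A := by
  have hconst : ∀ f : X, ∃ a : ℝ, ∀ᵐ ω ∂μ, ω ∈ A → (f : Ω →ₘ[μ] ℝ) ω = a := fun f => by
    -- Preimages of measurable sets are null or conull in the atom, and measurable sets separate the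
    -- reals.
    obtain ⟨a, ha⟩ := Filter.exists_eventuallyEq_const_of_forall_separating
      (l := ae (μ.restrict A)) (f := (f : Ω →ₘ[μ] ℝ)) MeasurableSet (fun U hU => by
        have hm : MeasurableSet ((f : Ω →ₘ[μ] ℝ) ⁻¹' U) :=
          (AEEqFun.measurable (f : Ω →ₘ[μ] ℝ)) hU
        rw [ae_restrict_iff' hA, ae_restrict_iff' hA]
        rcases h _ Set.inter_subset_left (hA.inter hm) with h0 | h0
        · right
          filter_upwards [measure_eq_zero_iff_ae_notMem.1 h0] with ω h1 h2 h3
          exact h1 ⟨h2, h3⟩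
        · left
          filter_upwards [measure_eq_zero_iff_ae_notMem.1 h0] with ω h1 h2
          by_contra h3
          exact h1 ⟨h2, fun h4 => h3 h4.2⟩)
    exact ⟨a, (ae_restrict_iff' hA).1 ha⟩
  by_cases hz : ∀ f, X.proj hA f = 0
  · exact ⟨0, fun _ f => by simp [hz]⟩
  push Not at hz
  obtain ⟨u, hu⟩ := hz
  obtain ⟨b, hb⟩ := hconst u
  have hb0 : b ≠ 0 := by
    rintro rfl
    refine hu (X.ext_ae (Filter.EventuallyEq.trans ?_ AEEqFun.coeFn_zero.symm))
    filter_upwards [hb, X.coeFn_proj hA u] with ω h1 h2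
    rw [h2]
    by_cases hω : ω ∈ A <;> simp [hω, h1]
  refine ⟨‖X.proj hA (S (X.proj hA u))‖ / ‖X.proj hA u‖, fun _ f => ?_⟩
  obtain ⟨a, ha⟩ := hconst f
  have hf : X.proj hA f = (a / b) • X.proj hA u := by
    refine X.ext_ae (Filter.EventuallyEq.trans ?_
      (AEEqFun.coeFn_smul (a / b) (X.proj hA u : Ω →ₘ[μ] ℝ)).symm)
    filter_upwards [ha, hb, X.coeFn_proj hA u, X.coeFn_proj hA f] with ω h1 h2 h3 h4
    rw [h4, Pi.smul_apply, h3]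
    by_cases hω : ω ∈ A
    · simp [hω, h1, h2, hb0]
    · simp [hω]
  have hn := X.norm_proj_le hA f
  have hu0 : 0 < ‖X.proj hA u‖ := norm_pos_iff.2 hu
  rw [hf, norm_smul] at hn
  rw [hf, map_smul, map_smul, norm_smul, div_mul_eq_mul_div, le_div_iff₀ hu0]
  nlinarith [norm_nonneg (X.proj hA (S (X.proj hA u)))]

/-- A set where `S` is unbounded contains a set where `S` is large and whose complement
is still a set where `S` is unbounded. -/
theorem exists_split_of_unbounded [SigmaFinite μ] {c : ℝ} (hc : HasFatouNormWith X c)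
    (hS : IsEpsBandPreserving ε S) (hε : 0 ≤ ε) (hA : MeasurableSet A)
    (hbad : ¬ ∃ C, X.CompressionBound S C A) (N : ℝ) :
    ∃ D ⊆ A, MeasurableSet D ∧ ¬ X.CompressionBound S N D ∧
      ¬ ∃ C, X.CompressionBound S C (A \ D) := by
  by_contra! hcon
  -- Under `hcon`, membership in `G` is equivalent, for measurable subsets of `A`, to having some
  -- compression bound, and then `N` is already a bound. Hence `G` is closed under finite unions.
  let G : Set (Set Ω) := {D | D ⊆ A ∧ MeasurableSet D ∧ ¬ ∃ C, X.CompressionBound S C (A \ D)}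
  have hGbd : ∀ D ∈ G, X.CompressionBound S N D := fun D hD => by
    by_contra h
    exact hD.2.2 (hcon D hD.1 hD.2.1 h)
  have hGmk : ∀ D ⊆ A, MeasurableSet D → (∃ C, X.CompressionBound S C D) → D ∈ G :=
    fun D hD hDm hDb => ⟨hD, hDm, fun h => hbad <| by
      have := exists_compressionBound_union hS hε hDb h hDm (hA.diff hDm)
      rwa [Set.union_sdiff_cancel hD] at this⟩
  have hGunion : ∀ D ∈ G, ∀ D' ∈ G, D ∪ D' ∈ G := fun D hD D' hD' =>
    hGmk _ (Set.union_subset hD.1 hD'.1) (hD.2.1.union hD'.2.1)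
      (exists_compressionBound_union hS hε ⟨N, hGbd D hD⟩ ⟨N, hGbd D' hD'⟩ hD.2.1 hD'.2.1)
  have hGempty : ∅ ∈ G := ⟨Set.empty_subset _, MeasurableSet.empty, by rwa [Set.sdiff_empty]⟩
  -- A finite measure with the same null sets, so that measures can be cancelled in the exhaustion.
  let ν := μ.toFinite
  obtain ⟨m, -, hm, hmG⟩ := exists_seq_tendsto_sSup (S := ν '' G) ⟨_, _, hGempty, rfl⟩
    (OrderTop.bddAbove _)
  choose D hDG hDm using hmG
  let E : ℕ → Set Ω := Set.accumulate D
  have hEG : ∀ n, E n ∈ G := fun n => by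
    induction n with
    | zero => simpa [E] using hDG 0
    | succ k ih =>
      have : E (k + 1) = E k ∪ D (k + 1) := Set.accumulate_succ D k
      rw [this]
      exact hGunion _ ih _ (hDG _)
  have hEm : ∀ n, MeasurableSet (E n) := fun n => (hEG n).2.1
  let F : Set Ω := ⋃ n, E n
  have hFm : MeasurableSet F := MeasurableSet.iUnion hEm
  have hFA : F ⊆ A := Set.iUnion_subset fun n => (hEG n).1
  have hsF : sSup (ν '' G) ≤ ν F := le_of_tendsto' hm fun n => by
    rw [← hDm]
    exact measure_mono ((Set.subset_accumulate (s := D) (x := n)).trans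
      (Set.subset_iUnion E n))
  -- Over `E n` the image of the part of `f` on `E n` costs `N` and that of the part on `F \ E n`
  -- costs `ε`. This is uniform in `n`, so Fatou carries it to the union.
  have hFG : F ∈ G := hGmk F hFA hFm ⟨|c| * (N + ε), fun _ f => by
    rw [mul_assoc]
    refine X.norm_proj_iUnion_le hc hEm Set.monotone_accumulate _ fun n => ?_
    have hsub : E n ⊆ F := Set.subset_iUnion E n
    have e : X.proj hFm f = X.proj (hEm n) f + X.proj (hFm.diff (hEm n)) f := by
      rw [X.proj_add_proj_of_disjoint _ _ Set.disjoint_sdiff_right]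
      simp only [Set.union_sdiff_cancel hsub]
    rw [e, map_add, map_add, add_mul]
    exact (norm_add_le _ _).trans (add_le_add (hGbd _ (hEG n) (hEm n) f)
      (X.norm_proj_apply_proj_le hS hε (hEm n) (hFm.diff (hEm n)) Set.disjoint_sdiff_right f))⟩
  -- `ν F` is maximal over `G`, so any admissible enlargement of `F` is null.
  have hnull : ∀ H ⊆ A \ F, MeasurableSet H →
      (¬ ∃ C, X.CompressionBound S C ((A \ F) \ H)) → μ H = 0 := fun H hH hHm hHb => by
    have hG : F ∪ H ∈ G := ⟨Set.union_subset hFA (hH.trans Set.sdiff_subset), hFm.union hHm, by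
      rwa [← Set.sdiff_sdiff]⟩
    have h1 : ν (F ∪ H) ≤ ν F := (le_sSup (Set.mem_image_of_mem ν hG)).trans hsF
    rw [measure_union (Set.disjoint_of_subset_right hH Set.disjoint_sdiff_right) hHm] at h1
    have h2 : ν H = 0 := by
      have := ENNReal.add_le_add_iff_left (measure_ne_top ν F) (b := ν H) (c := 0)
      simpa using this.1 (by simpa using h1)
    exact absolutelyContinuous_toFinite μ h2
  refine hFG.2.2 (exists_compressionBound_of_atom S (hA.diff hFm) fun H hH hHm => ?_)
  -- `A \ F` is bad, so `H` and its complement there cannot both be good. The complement of a bad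
  -- one is null by `hnull`.
  by_cases hb : ∃ C, X.CompressionBound S C ((A \ F) \ H)
  · right
    refine hnull _ Set.sdiff_subset ((hA.diff hFm).diff hHm) fun hb' => hFG.2.2 ?_
    rw [Set.sdiff_sdiff_cancel_left hH] at hb'
    have := exists_compressionBound_union hS hε hb' hb hHm ((hA.diff hFm).diff hHm)
    rwa [Set.union_sdiff_cancel hH] at this
  · exact Or.inl (hnull H hH hHm hb)

theorem continuous_of_isEpsBandPreserving [SigmaFinite μ] (hX : HasFatouProperty X)
    (hS : IsEpsBandPreserving ε S) : Continuous S := by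
  obtain ⟨c, hc⟩ := hX
  replace hS := hS.mono (le_abs_self ε)
  have hε := abs_nonneg ε
  have key : ∃ C, X.CompressionBound S C Set.univ := by
    by_contra hbad
    obtain ⟨D, hD, hDQ⟩ := exists_pairwise_disjoint_seq
      (P := fun A => MeasurableSet A ∧ ¬ ∃ C, X.CompressionBound S C A)
      (Q := fun n D => MeasurableSet D ∧ ¬ X.CompressionBound S (2 ^ n * n) D)
      (fun n A hA => by
        obtain ⟨D, hDA, hDm, hD, hD'⟩ :=
          exists_split_of_unbounded hc hS hε hA.1 hA.2 (2 ^ n * n)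
        exact ⟨D, A \ D, hDA, Set.sdiff_subset, Set.disjoint_sdiff_right, ⟨hDm, hD⟩,
          hA.1.diff hDm, hD'⟩) ⟨MeasurableSet.univ, hbad⟩
    have hDm := fun n => (hDQ n).1
    have hex : ∀ n : ℕ, ∃ f : X,
        2 ^ n * n * ‖f‖ < ‖X.proj (hDm n) (S (X.proj (hDm n) f))‖ := fun n => by
      have := (hDQ n).2
      unfold CompressionBound at this
      push Not at this
      obtain ⟨_, f, hf⟩ := this
      exact ⟨f, hf⟩
    choose f hf using hex
    refine gliding_hump S (fun n => X.proj (hDm n)) (fun n => X.norm_proj_le (hDm n))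
      (fun n => X.proj (hDm n) (f n)) hε (fun a x hx n => ?_) (fun n => ?_)
    · refine X.norm_proj_apply_le hS (hDm n) ?_
      -- Projections are continuous, so they act termwise on the series, and only the `n`-th term
      -- survives.
      have h1 := ((X.proj (hDm n)).mkContinuous 1 fun g => by
        rw [one_mul]; exact X.norm_proj_le (hDm n) g).hasSum hx
      have h2 : ∀ m ≠ n, X.proj (hDm n) (a m • X.proj (hDm m) (f m)) = 0 := fun m hm => by
        rw [map_smul, proj_proj, X.proj_eq_zero_of_null, smul_zero]
        rw [(hD n m hm.symm).inter_eq, measure_empty]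
      have h3 := h1.unique (hasSum_single n h2)
      rw [map_sub, sub_eq_zero]
      exact h3
    · refine lt_of_le_of_lt ?_ (hf n)
      exact mul_le_mul_of_nonneg_left (X.norm_proj_le (hDm n) (f n)) (by positivity)
  obtain ⟨C, hC⟩ := key
  have huniv : ∀ g, X.proj MeasurableSet.univ g = g := fun g => X.ext_ae <| by
    filter_upwards [X.coeFn_proj MeasurableSet.univ g] with ω h
    rw [h, Set.indicator_univ]
  refine AddMonoidHomClass.continuous_of_bound S C fun g => ?_
  simpa only [huniv] using hC MeasurableSet.univ g

end KotheFunctionSpace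

/-! ### Cutoffs and localization in `C₀(K, E)` -/

open Filter Topology in
theorem exists_continuous_bump {K : Type*} [TopologicalSpace K] [LocallyCompactSpace K] [T2Space K]
    {U : Set K} (hU : IsOpen U) {t : K} (ht : t ∈ U) :
    ∃ φ : C(K, ℝ), (∀ᶠ s in 𝓝 t, φ s = 1) ∧ (∀ s ∉ U, φ s = 0) ∧ ∀ s, ‖φ s‖ ≤ 1 := by
  obtain ⟨C, hC, htC, hCU⟩ := exists_compact_subset hU ht
  obtain ⟨φ, h1, h0, -, h01⟩ := exists_continuous_one_zero_of_isCompact hC hU.isClosed_compl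
    (Set.disjoint_compl_right_iff_subset.2 hCU)
  refine ⟨φ, ?_, fun s hs => h0 hs, fun s => ?_⟩
  · filter_upwards [mem_interior_iff_mem_nhds.1 htC] with s hs using h1 hs
  · rw [Real.norm_of_nonneg (h01 s).1]
    exact (h01 s).2

namespace ZeroAtInftyContinuousMap

section Normed

variable {K E : Type*} [TopologicalSpace K] [NormedAddCommGroup E]

theorem norm_apply_le (f : C₀(K, E)) (t : K) : ‖f t‖ ≤ ‖f‖ :=
  f.toBCF.norm_coe_le_norm t

theorem norm_le_of_forall {f : C₀(K, E)} {C : ℝ} (hC : 0 ≤ C) (h : ∀ t, ‖f t‖ ≤ C) : ‖f‖ ≤ C :=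
  (BoundedContinuousFunction.norm_le (f := f.toBCF) hC).2 h

variable [NormedSpace ℝ E]

/-- Evaluation at a point as a linear map. -/
def evalₗ (t : K) : C₀(K, E) →ₗ[ℝ] E where
  toFun f := f t
  map_add' _ _ := rfl
  map_smul' _ _ := rfl

@[simp] theorem evalₗ_apply (t : K) (f : C₀(K, E)) : evalₗ t f = f t := rfl

theorem hasSum_apply {ι : Type*} {f : ι → C₀(K, E)} {g : C₀(K, E)} (h : HasSum f g) (t : K) :
    HasSum (fun i => f i t) (g t) :=
  ((evalₗ (E := E) t).mkContinuous 1 fun f => by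
    rw [one_mul]; exact norm_apply_le f t).hasSum h

/-- The product of a function in `C₀(K, E)` with a continuous function bounded by `1`. -/
def cutoff (φ : C(K, ℝ)) (hφ : ∀ s, ‖φ s‖ ≤ 1) (f : C₀(K, E)) : C₀(K, E) where
  toFun s := φ s • f s
  continuous_toFun := φ.continuous.smul (map_continuous f)
  zero_at_infty' := by
    refine squeeze_zero_norm (fun s => ?_) (tendsto_zero_iff_norm_tendsto_zero.1 (zero_at_infty f))
    rw [norm_smul]
    exact mul_le_of_le_one_left (norm_nonneg _) (hφ s)

@[simp] theorem cutoff_apply (φ : C(K, ℝ)) (hφ : ∀ s, ‖φ s‖ ≤ 1) (f : C₀(K, E)) (s : K) :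
    cutoff φ hφ f s = φ s • f s := rfl

theorem norm_cutoff_le (φ : C(K, ℝ)) (hφ : ∀ s, ‖φ s‖ ≤ 1) (f : C₀(K, E)) :
    ‖cutoff φ hφ f‖ ≤ ‖f‖ :=
  norm_le_of_forall (norm_nonneg f) fun s => by
    rw [cutoff_apply, norm_smul]
    exact (mul_le_of_le_one_left (norm_nonneg _) (hφ s)).trans (norm_apply_le f s)

open scoped Classical in
/-- The function with value `u` at an isolated point `t` and `0` elsewhere, as a linear map. -/
noncomputable def single [T1Space K] {t : K} (ht : IsOpen {t}) : E →ₗ[ℝ] C₀(K, E) where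
  toFun u :=
    { toFun := fun s => if s = t then u else 0
      continuous_toFun := by
        have h : IsClopen {s : K | s = t} := ⟨isClosed_singleton, ht⟩
        refine continuous_const.if (fun s hs => ?_) continuous_const
        rw [h.frontier_eq] at hs
        exact hs.elim
      zero_at_infty' := by
        refine tendsto_const_nhds.congr' ?_
        filter_upwards [(isCompact_singleton (x := t)).compl_mem_cocompact] with s hs
        exact (if_neg hs).symm }
  map_add' u v := by
    ext s
    by_cases h : s = t <;> simp [h]
  map_smul' c u := by
    ext s
    by_cases h : s = t <;> simp [h]

theorem single_self [T1Space K] {t : K} (ht : IsOpen {t}) (u : E) : single ht u t = u :=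
  if_pos rfl

theorem single_of_ne [T1Space K] {t s : K} (ht : IsOpen {t}) (u : E) (h : s ≠ t) :
    single ht u s = 0 :=
  if_neg h

theorem norm_single_le [T1Space K] {t : K} (ht : IsOpen {t}) (u : E) : ‖single ht u‖ ≤ ‖u‖ :=
  norm_le_of_forall (norm_nonneg u) fun s => by
    by_cases h : s = t
    · rw [h, single_self]
    · rw [single_of_ne ht u h, norm_zero]; exact norm_nonneg u

end Normed

open Filter Topology

variable {K E : Type*} [TopologicalSpace K] [LocallyCompactSpace K] [T2Space K]
  [NormedAddCommGroup E] [NormedSpace ℝ E] [Lattice E] [HasSolidNorm E] [IsOrderedAddMonoid E]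
  {ε : ℝ} {T : C₀(K, E) →ₗ[ℝ] C₀(K, E)}

/-- Functions vanishing near `t` have images almost vanishing at `t`. -/
theorem norm_map_apply_le (hT : IsEpsBandPreserving ε T) {f : C₀(K, E)} {U : Set K}
    (hU : IsOpen U) (hf : ∀ s ∈ U, f s = 0) {t : K} (ht : t ∈ U) :
    ‖T f t‖ ≤ ε * ‖f‖ := by
  obtain ⟨φ, h1, h0, hφ⟩ := exists_continuous_bump hU ht
  -- The cutoff makes the test vector disjoint from `f` without changing its value at `t`.
  have h := hT f |cutoff φ hφ (T f)| (fun s => abs_nonneg (φ s • T f s)) (by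
    ext s
    change |(|φ s • T f s|)| ⊓ |f s| = 0
    by_cases hs : s ∈ U
    · rw [hf s hs, abs_zero]
      exact inf_eq_right.2 (abs_nonneg _)
    · rw [h0 s hs, zero_smul, abs_zero, abs_zero]
      exact inf_eq_left.2 (abs_nonneg _))
  have h2 := (norm_apply_le _ t).trans h
  change ‖|T f t| ⊓ |φ t • T f t|‖ ≤ _ at h2
  rwa [h1.self_of_nhds, one_smul, inf_idem, norm_abs_eq_norm] at h2

/-- At an isolated point the values of `T f` are controlled by `‖f‖`. -/
theorem exists_bound_of_isolated
    (hE : ∀ (δ : ℝ) (S : E →ₗ[ℝ] E), IsEpsBandPreserving δ S → Continuous S)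
    (hT : IsEpsBandPreserving ε T) (hε : 0 ≤ ε) {t : K} (ht : IsOpen {t}) :
    ∃ C, ∀ f, ‖T f t‖ ≤ C * ‖f‖ := by
  -- Compressing `T` to the fibre over `t` keeps it `ε`-band preserving, so `hE` applies.
  have hS : IsEpsBandPreserving ε (evalₗ t ∘ₗ T ∘ₗ single ht) := fun u y hy hd => by
    have h := hT (single ht u) (single ht y)
      (fun s => by
        change 0 ≤ single ht y s
        by_cases hs : s = t
        · rw [hs, single_self]; exact hy
        · rw [single_of_ne ht y hs])
      (by
        ext s
        change |single ht y s| ⊓ |single ht u s| = 0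
        by_cases hs : s = t
        · rw [hs, single_self, single_self, hd]
        · rw [single_of_ne ht y hs, single_of_ne ht u hs, inf_idem, abs_zero])
    have h2 := (norm_apply_le _ t).trans h
    change ‖|T (single ht u) t| ⊓ single ht y t‖ ≤ _ at h2
    rw [single_self] at h2
    exact h2.trans (mul_le_mul_of_nonneg_left (norm_single_le ht u) hε)
  let S : E →L[ℝ] E := ⟨_, hE ε _ hS⟩
  refine ⟨‖S‖ + ε * 2, fun f => ?_⟩
  have h1 : ‖T (single ht (f t)) t‖ ≤ ‖S‖ * ‖f‖ :=
    (S.le_opNorm (f t)).trans (mul_le_mul_of_nonneg_left (norm_apply_le f t) (norm_nonneg S))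
  have h2 : ‖T (f - single ht (f t)) t‖ ≤ ε * ‖f - single ht (f t)‖ :=
    norm_map_apply_le hT ht (fun s hs => by
      rw [Set.mem_singleton_iff.1 hs, sub_apply, single_self, sub_self]) rfl
  have h3 : ‖f - single ht (f t)‖ ≤ 2 * ‖f‖ := by
    have := norm_sub_le f (single ht (f t))
    have := norm_single_le ht (f t)
    linarith [norm_apply_le f t]
  have h4 : T f t = T (single ht (f t)) t + T (f - single ht (f t)) t := by
    rw [map_sub, sub_apply, add_sub_cancel]
  rw [h4]
  have := norm_add_le (T (single ht (f t)) t) (T (f - single ht (f t)) t)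
  nlinarith

/-- A large value of `T f` at `t` is produced by the part of `f` near `t`. -/
theorem exists_localized (hT : IsEpsBandPreserving ε T) (hε : 0 ≤ ε) {U : Set K}
    (hU : IsOpen U) {t : K} (ht : t ∈ U) {N : ℝ} (hN : 0 ≤ N) {f : C₀(K, E)}
    (hf : (N + 2 * ε) * ‖f‖ < ‖T f t‖) :
    ∃ g : C₀(K, E), (∀ s ∉ U, g s = 0) ∧ N * ‖g‖ < ‖T g t‖ := by
  obtain ⟨φ, h1, h0, hφ⟩ := exists_continuous_bump hU ht
  refine ⟨cutoff φ hφ f, fun s hs => by rw [cutoff_apply, h0 s hs, zero_smul], ?_⟩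
  obtain ⟨W, hW, hWo, htW⟩ := eventually_nhds_iff.1 h1
  -- The removed part vanishes near `t` and has norm at most `2 * ‖f‖`, which accounts for the `2 *
  -- ε` in `hf`.
  have h2 : ‖T (f - cutoff φ hφ f) t‖ ≤ ε * ‖f - cutoff φ hφ f‖ :=
    norm_map_apply_le hT hWo (fun s hs => by
      rw [sub_apply, cutoff_apply, hW s hs, one_smul, sub_self]) htW
  have h3 := norm_cutoff_le φ hφ f
  have h4 := norm_sub_le f (cutoff φ hφ f)
  have h5 : T f t = T (cutoff φ hφ f) t + T (f - cutoff φ hφ f) t := by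
    rw [map_sub, sub_apply, add_sub_cancel]
  have h6 := norm_add_le (T (cutoff φ hφ f) t) (T (f - cutoff φ hφ f) t)
  rw [← h5] at h6
  nlinarith

/-- An open set where `T` is unbounded contains a point where `T` is large, and a disjoint open
set where `T` is still unbounded. -/
theorem exists_split_of_unbounded
    (hE : ∀ (δ : ℝ) (S : E →ₗ[ℝ] E), IsEpsBandPreserving δ S → Continuous S)
    (hT : IsEpsBandPreserving ε T) (hε : 0 ≤ ε) {U : Set K} (hU : IsOpen U)
    (hbad : ∀ C : ℝ, ∃ t ∈ U, ∃ f, C * ‖f‖ < ‖T f t‖) (N : ℝ) :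
    ∃ V W : Set K, V ⊆ U ∧ W ⊆ U ∧ Disjoint V W ∧
      (IsOpen V ∧ ∃ t ∈ V, ∃ f, N * ‖f‖ < ‖T f t‖) ∧
      IsOpen W ∧ ∀ C : ℝ, ∃ t ∈ W, ∃ f, C * ‖f‖ < ‖T f t‖ := by
  obtain ⟨t, htU, f, hf⟩ := hbad N
  by_cases ht : IsOpen {t}
  · refine ⟨{t}, U \ {t}, Set.singleton_subset_iff.2 htU, Set.sdiff_subset,
      Set.disjoint_sdiff_right, ⟨ht, t, rfl, f, hf⟩, hU.sdiff isClosed_singleton, fun C => ?_⟩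
    obtain ⟨B, hB⟩ := exists_bound_of_isolated hE hT hε ht
    obtain ⟨s, hsU, g, hg⟩ := hbad (max B C)
    refine ⟨s, ⟨hsU, ?_⟩, g,
      (mul_le_mul_of_nonneg_right (le_max_right B C) (norm_nonneg g)).trans_lt hg⟩
    rintro rfl
    exact absurd (hB g) (not_le.2
      ((mul_le_mul_of_nonneg_right (le_max_left B C) (norm_nonneg g)).trans_lt hg))
  · have hne : (𝓝[≠] t).NeBot := by
      rw [neBot_iff, Ne, ← isOpen_singleton_iff_punctured_nhds]
      exact ht
    -- By continuity of `T f`, the same `f` is a witness at a second point `s ≠ t`.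
    have hnear : ∀ᶠ s in 𝓝 t, s ∈ U ∧ N * ‖f‖ < ‖T f s‖ :=
      (hU.eventually_mem htU).and
        ((map_continuous (T f)).norm.continuousAt.eventually (lt_mem_nhds hf))
    obtain ⟨s, ⟨hsU, hs⟩, hst⟩ :=
      ((hnear.filter_mono nhdsWithin_le_nhds).and
        (self_mem_nhdsWithin : {t}ᶜ ∈ 𝓝[≠] t)).exists
    obtain ⟨A, htA, hAo, B, hsB, hBo, hAB⟩ := exists_open_nhds_disjoint_closure (Ne.symm hst)
    by_cases hA : ∀ C : ℝ, ∃ t ∈ U \ closure A, ∃ f, C * ‖f‖ < ‖T f t‖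
    · exact ⟨U ∩ A, U \ closure A, Set.inter_subset_left, Set.sdiff_subset,
        Set.disjoint_left.2 fun x hx hx' => hx'.2 (subset_closure hx.2),
        ⟨hU.inter hAo, t, ⟨htU, htA⟩, f, hf⟩, hU.sdiff isClosed_closure, hA⟩
    -- If `T` is bounded off `closure A`, its unboundedness sits inside `closure A`, hence off
    -- `closure B`; the roles of `t` and `s` are exchanged.
    · refine ⟨U ∩ B, U \ closure B, Set.inter_subset_left, Set.sdiff_subset,
        Set.disjoint_left.2 fun x hx hx' => hx'.2 (subset_closure hx.2),
        ⟨hU.inter hBo, s, ⟨hsU, hsB⟩, f, hs⟩, hU.sdiff isClosed_closure, fun C => ?_⟩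
      push Not at hA
      obtain ⟨M, hM⟩ := hA
      obtain ⟨r, hrU, g, hg⟩ := hbad (max M C)
      refine ⟨r, ⟨hrU, fun hrB => ?_⟩, g,
        (mul_le_mul_of_nonneg_right (le_max_right M C) (norm_nonneg g)).trans_lt hg⟩
      exact absurd (hM r ⟨hrU, Set.disjoint_right.1 hAB hrB⟩ g) (not_le.2
        ((mul_le_mul_of_nonneg_right (le_max_left M C) (norm_nonneg g)).trans_lt hg))

/-- If all almost band preserving linear maps on `E` are continuous, then so are those on
`C₀(K, E)`. -/
theorem continuous_of_isEpsBandPreserving [CompleteSpace E]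
    (hE : ∀ (δ : ℝ) (S : E →ₗ[ℝ] E), IsEpsBandPreserving δ S → Continuous S)
    (hT : IsEpsBandPreserving ε T) : Continuous T := by
  replace hT := hT.mono (le_abs_self ε)
  have hε := abs_nonneg ε
  have key : ∃ C, ∀ t f, ‖T f t‖ ≤ C * ‖f‖ := by
    by_contra! hbad
    obtain ⟨V, hV, hVQ⟩ := exists_pairwise_disjoint_seq
      (P := fun U : Set K => IsOpen U ∧ ∀ C : ℝ, ∃ t ∈ U, ∃ f, C * ‖f‖ < ‖T f t‖)
      (Q := fun n V => IsOpen V ∧ ∃ t ∈ V, ∃ f, (2 ^ n * n + 2 * |ε|) * ‖f‖ < ‖T f t‖)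
      (fun n U hU => exists_split_of_unbounded hE hT hε hU.1 hU.2 _)
      (U₀ := Set.univ) ⟨isOpen_univ, fun C => by
        obtain ⟨t, f, h⟩ := hbad C
        exact ⟨t, trivial, f, h⟩⟩
    have hVo := fun n => (hVQ n).1
    choose t htV f hf using fun n => (hVQ n).2
    choose g hgV hg using fun n =>
      exists_localized hT hε (hVo n) (htV n) (by positivity) (hf n)
    refine gliding_hump T (fun n => evalₗ (t n)) (fun n v => norm_apply_le v (t n)) g hε
      (fun a x hx n => norm_map_apply_le hT (hVo n) (fun s hs => ?_) (htV n)) hg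
    have h1 := (hasSum_apply hx s).unique (hasSum_single n fun m hm => by
      rw [smul_apply, hgV m s (Set.disjoint_left.1 (hV n m hm.symm) hs), smul_zero])
    rw [sub_apply, h1, sub_self]
  obtain ⟨C, hC⟩ := key
  refine AddMonoidHomClass.continuous_of_bound T |C| fun f => ?_
  exact norm_le_of_forall (by positivity) fun t =>
    (hC t f).trans (mul_le_mul_of_nonneg_right (le_abs_self C) (norm_nonneg f))

end ZeroAtInftyContinuousMap

theorem theorem3p3 :
    (∀ {Ω K : Type*} [MeasurableSpace Ω] (μ : Measure Ω) [SigmaFinite μ]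
      [TopologicalSpace K] [LocallyCompactSpace K] [T2Space K]
      (X : KotheFunctionSpace μ), HasFatouProperty X →
      ∀ (ε : ℝ) (T : C₀(K, X) →ₗ[ℝ] C₀(K, X)), IsEpsBandPreserving ε T → Continuous T) ∧
    (∀ {K : Type*} [TopologicalSpace K] [LocallyCompactSpace K] [T2Space K]
      (ε : ℝ) (T : C₀(K, ℝ) →ₗ[ℝ] C₀(K, ℝ)), IsEpsBandPreserving ε T → Continuous T) := by
  refine ⟨?_, ?_⟩
  · intro Ω K _ μ _ _ _ _ X hX ε T hT
    exact ZeroAtInftyContinuousMap.continuous_of_isEpsBandPreserving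
      (fun _ _ hS => KotheFunctionSpace.continuous_of_isEpsBandPreserving hX hS) hT
  · intro K _ _ _ ε T hT
    exact ZeroAtInftyContinuousMap.continuous_of_isEpsBandPreserving
      -- For `E = ℝ` the fibre hypothesis is automatic, so no Fatou argument is needed.
      (fun _ S _ => S.continuous_of_finiteDimensional) hT
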